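/- Let $T_L:[0,1]\to[0,1]$ be the Lüroth map, $T_L(0)=0$, $T_L(1)=1$ and $T_L(x)=\lceil 1/x\rceil(\lceil 1/x\rceil-1)x-(\lceil 1/x\rceil-1)$ otherwise, and let $T_A=1-T_L$. For $0<c\le\frac12$ put $z_n=\frac1n$, $z_n^+=z_n+cz_nz_{n-1}$ ($n\ge2$) and $z_n^-=z_n-cz_nz_{n+1}$ ($n\ge1$). On $[c,1]$ let $T_{0,c}=T_A$ on $\bigcup_{n\ge2}[z_n,z_n^+)$ and $T_{0,c}=T_L$ elsewhere; let $T_{1,c}=T_A$ on $\bigcup_{n\ge2}[z_n,z_{n-1}^-]$ and $T_{1,c}=T_L$ elsewhere; and let $S=[c,1]\cap\bigcup_{n\ge2}[z_n^+,z_{n-1}^-]$. The random $c$-Lüroth transformation is $$L_c:\{0,1\}^{\mathbb N}\times[c,1]\to\{0,1\}^{\mathbb N}\times[c,1],\qquad L_c(\omega,x)=(\sigma\omega,T_{\omega_1,c}(x)),$$ where $\sigma$ is the left shift. It generates from $(\omega,x)$ the sequence $(s_n,d_n)_{n\ge1}$ given by $s_n=s(L_c^{n-1}(\omega,x))$ and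 $d_n=d(L_c^{n-1}(\omega,x))$. Here $s(\omega,y)=0$ if $y\in S$ and $\omega_1=0$, or if $y\in\{1\}\cup\bigcup_{n\ge1}(z_n^-,z_n)$, and $s(\omega,y)=1$ otherwise; $d(\omega,y)=2$ if $y=1$, and $d(\omega,y)=n$ if $y\in[\frac1n,\frac1{n-1})$, $n\ge2$. A $c$-Lüroth expansion of $x$ is an expansion $$x=\sum_{n\ge1}(-1)^{\sum_{i=1}^{n-1}s_i}\,\frac{d_n-1+s_n}{\prod_{i=1}^n d_i(d_i-1)},\qquad s_n\in\{0,1\},\ d_n\ge2,$$ whose sequence $(s_n,d_n)_n$ is generated by $L_c$ from $(\omega,x)$ for some $\omega\in\{0,1\}^{\mathbb N}$; two expansions are different if their sequences $(s_n,d_n)_n$ are different. A $c$-Lüroth expansion is called universal if every finite block of elements of $\{0,1\}\times\{2,\dots,\lceil 1/c\rceil\}$ occurs in $(s_n,d_n)_n$. (i) If $0<c\le\frac25$, then every irrational $x\in[c,1]$ has uncountably many different $c$-Lüroth expansions. (ii) If $c=\frac1\ell$ for some integer $\ell\ge3$, then Lebesgue almost every $x\in[\frac1\ell,1]$ has uncountably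 many different universal $c$-Lüroth expansions with all digits $d_n$ at most $\ell$. -/

import Mathlib

open Set MeasureTheory

noncomputable section

namespace Luroth

/-- The standard Lüroth map on `[0,1]`. -/
def TL (x : ℝ) : ℝ :=
  if x = 0 then 0
  else if x = 1 then 1
  else (⌈1 / x⌉ : ℝ) * ((⌈1 / x⌉ : ℝ) - 1) * x - ((⌈1 / x⌉ : ℝ) - 1)

/-- The alternating Lüroth map on `[0,1]`. -/
def TA (x : ℝ) : ℝ := 1 - TL x

/-- `z_n = 1 / n`. -/
def z (n : ℕ) : ℝ := 1 / (n : ℝ)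

/-- `z_n⁺ = z_n + c z_n z_{n-1}`, used for `n ≥ 2` only. -/
def zPlus (c : ℝ) (n : ℕ) : ℝ := z n + c * z n * z (n - 1)

/-- `z_n⁻ = z_n - c z_n z_{n+1}`, used for `n ≥ 1` only. -/
def zMinus (c : ℝ) (n : ℕ) : ℝ := z n - c * z n * z (n + 1)

open Classical in
/-- The map `T_{0,c}`: it is `T_A` on `{0}` and on all `[z_n, z_n⁺)`, `n ≥ 2`, and `T_L` on the
rest of `[0,1]`, that is on `{1}` and on all `[z_n⁺, z_{n-1})`, `n ≥ 2`. -/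
def T0 (c x : ℝ) : ℝ :=
  if x = 0 ∨ ∃ n : ℕ, 2 ≤ n ∧ x ∈ Ico (z n) (zPlus c n) then TA x else TL x

open Classical in
/-- The map `T_{1,c}`: it is `T_A` on `{0}` and on all `[z_n, z_{n-1}⁻]`, `n ≥ 2`, and `T_L` on the
rest of `[0,1]`, that is on `{1}` and on all `(z_{n-1}⁻, z_{n-1})`, `n ≥ 2`. -/
def T1 (c x : ℝ) : ℝ :=
  if x = 0 ∨ ∃ n : ℕ, 2 ≤ n ∧ x ∈ Icc (z n) (zMinus c (n - 1)) then TA x else TL x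

/-- `T_{j,c}` for `j ∈ {0,1}`. -/
def T (c : ℝ) (j : Fin 2) (x : ℝ) : ℝ := if j = 0 then T0 c x else T1 c x

/-- The random `c`-Lüroth transformation `L_c(ω, x) = (σ ω, T_{ω_1,c} x)`, with the first symbol
`ω_1` stored at index `0`. It maps `{0,1}^ℕ × [c,1]` to itself for `0 < c ≤ 1/2`. -/
def L (c : ℝ) (q : (ℕ → Fin 2) × ℝ) : (ℕ → Fin 2) × ℝ :=
  (fun n => q.1 (n + 1), T c (q.1 0) q.2)

/-- The switch region `S`. -/
def switchRegion (c : ℝ) : Set ℝ :=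
  {x | x ∈ Icc c 1 ∧ ∃ n : ℕ, 2 ≤ n ∧ x ∈ Icc (zPlus c n) (zMinus c (n - 1))}

open Classical in
/-- The first sign `s_1(ω, x)`: it is `0` on `[0] × S` and on `{0,1}^ℕ × (⋃ₙ (z_n⁻, z_n) ∪ {1})`, and
`1` on the rest of the space, that is on `[1] × S` and on `{0,1}^ℕ × ⋃ₙ [z_n, z_n⁺)`. -/
def firstSign (c : ℝ) (q : (ℕ → Fin 2) × ℝ) : Fin 2 :=
  if (q.2 ∈ switchRegion c ∧ q.1 0 = 0) ∨ (∃ n : ℕ, 1 ≤ n ∧ q.2 ∈ Ioo (zMinus c n) (z n)) ∨ q.2 = 1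
  then 0 else 1

/-- The first digit `d_1(ω, x)`: it is `2` if `x = 1`, and `n` if `x ∈ [1/n, 1/(n-1))`, `n ≥ 2`
(equivalently `n - 1 < 1/x ≤ n`). -/
def firstDigit (x : ℝ) : ℕ := if x = 1 then 2 else ⌈1 / x⌉₊

/-- The sequence `(s_n(ω, x), d_n(ω, x))_n` of signs and digits generated by `L_c` from `(ω, x)`;
the entry of index `n` is `(s_{n+1}, d_{n+1})`. -/
def signDigitSeq (c : ℝ) (ω : ℕ → Fin 2) (x : ℝ) (n : ℕ) : Fin 2 × ℕ :=
  (firstSign c ((L c)^[n] (ω, x)), firstDigit ((L c)^[n] (ω, x)).2)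

/-- The sequence `a = (s_n, d_n)_n` of signs and digits is a generalised Lüroth expansion of `x`:
`d_n ≥ 2` for all `n`, and `x = ∑_n (-1)^{s_1 + ⋯ + s_{n-1}} (d_n - 1 + s_n) / ∏_{i ≤ n} d_i (d_i - 1)`. -/
def IsGeneralisedLurothExpansion (a : ℕ → Fin 2 × ℕ) (x : ℝ) : Prop :=
  (∀ n, 2 ≤ (a n).2) ∧
  HasSum (fun n : ℕ =>
    (-1 : ℝ) ^ (∑ i ∈ Finset.range n, ((a i).1 : ℕ)) *
      ((((a n).2 : ℝ) - 1 + (((a n).1 : ℕ) : ℝ)) /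
        ∏ i ∈ Finset.range (n + 1), (((a i).2 : ℝ) * (((a i).2 : ℝ) - 1)))) x

/-- The set of `c`-Lüroth expansions of `x`: the generalised Lüroth expansions of `x` that `L_c`
generates from some `(ω, x)`. Expansions are identified with their sequences of signs and digits. -/
def expansions (c x : ℝ) : Set (ℕ → Fin 2 × ℕ) :=
  {a | IsGeneralisedLurothExpansion a x ∧ ∃ ω : ℕ → Fin 2, a = signDigitSeq c ω x}

/-- The alphabet `{0,1} × {2, …, ⌈1/c⌉}`. -/
def alphabet (c : ℝ) : Set (Fin 2 × ℕ) := {t | 2 ≤ t.2 ∧ t.2 ≤ ⌈1 / c⌉₊}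

/-- The sequence `a` is universal: every finite block over the alphabet occurs in it. -/
def IsUniversal (c : ℝ) (a : ℕ → Fin 2 × ℕ) : Prop :=
  ∀ (j : ℕ) (w : Fin j → Fin 2 × ℕ), (∀ i, w i ∈ alphabet c) →
    ∃ k : ℕ, ∀ i : Fin j, a (k + i) = w i

end Luroth

end

open Filter Topology

namespace Luroth

variable {c x y : ℝ} {n : ℕ}

/-! On each digit interval `TL` is an affine coordinate `t`, and either random map sends the point
to `t` or `1 - t`. The choice is forced when `t < c` or `t > 1 - c`, and free on the switch region,
where the symbol of `ω` is the sign. The maps `branch` invert these steps, so every irrational orbit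
telescopes into an expansion.

Uncountability is a Baire argument in the space of `ω` (`not_countable_of_forall_signDigitSeq_mem`).
For a fixed sequence `a`, the `ω` that do not generate `a` form an open set. It is dense because
every irrational orbit meets the switch region (`exists_iterate_mem_switchRegion`), where the next
sign can be made to differ from that of `a`. No countable set of sequences can then contain
everything generated.

For universality, the conditions "the block `w` occurs" join the countable family of open sets. They
are dense once no point reachable from `x` lies in some `avoiding c w`. Those sets are null by
Lebesgue density (`volume_avoiding`), and so are their images under the countably many compositions
of branches. -/

/-! ### Digit intervals and the coordinate `TL x` -/

lemma z_pos (hn : 1 ≤ n) : 0 < z n := by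
  unfold z; positivity

lemma z_mul_z_pred (hn : 2 ≤ n) : z n * z (n - 1) = z (n - 1) - z n := by
  obtain ⟨m, rfl⟩ := Nat.exists_eq_add_of_le hn
  simp only [z, show 2 + m - 1 = m + 1 by omega]
  push_cast
  field_simp
  ring

lemma z_mul_z_pred_pos (hn : 2 ≤ n) : 0 < z n * z (n - 1) :=
  mul_pos (z_pos (by omega)) (z_pos (by omega))

lemma two_le_firstDigit (h0 : 0 < x) (h1 : x < 1) : 2 ≤ firstDigit x := by
  rw [firstDigit, if_neg h1.ne]
  have : 1 < ⌈1 / x⌉₊ := Nat.lt_ceil.2 (by rw [lt_div_iff₀ h0]; simpa using h1)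
  exact this

lemma eq_z_add_TL (h0 : 0 < x) (h1 : x < 1) :
    x = z (firstDigit x) + TL x * (z (firstDigit x) * z (firstDigit x - 1)) := by
  have h2 := two_le_firstDigit h0 h1
  have hd : (⌈1 / x⌉ : ℝ) = (firstDigit x : ℝ) := by
    rw [firstDigit, if_neg h1.ne]
    exact (natCast_ceil_eq_intCast_ceil (by positivity)).symm
  rw [TL, if_neg h0.ne', if_neg h1.ne, hd]
  obtain ⟨m, hm⟩ := Nat.exists_eq_add_of_le h2
  rw [hm]
  simp only [z, show 2 + m - 1 = m + 1 by omega]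
  push_cast
  field_simp
  ring

lemma mem_Ico_z_firstDigit (h0 : 0 < x) (h1 : x < 1) :
    x ∈ Ico (z (firstDigit x)) (z (firstDigit x - 1)) := by
  have h2 := two_le_firstDigit h0 h1
  have hd : firstDigit x = ⌈1 / x⌉₊ := by rw [firstDigit, if_neg h1.ne]
  constructor
  · rw [z, div_le_comm₀ (by positivity) h0, hd]
    exact Nat.le_ceil _
  · have h3 : (0 : ℝ) < ((firstDigit x - 1 : ℕ) : ℝ) := by
      exact_mod_cast (by omega : 0 < firstDigit x - 1)
    rw [z, lt_div_comm₀ h0 h3, ← Nat.lt_ceil, ← hd]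
    omega

lemma TL_mem_Ico (h0 : 0 < x) (h1 : x < 1) : TL x ∈ Ico (0 : ℝ) 1 := by
  have h2 := two_le_firstDigit h0 h1
  have h3 := eq_z_add_TL h0 h1
  have h4 := z_mul_z_pred_pos h2
  have h5 := z_mul_z_pred h2
  obtain ⟨h6, h7⟩ := mem_Ico_z_firstDigit h0 h1
  generalize z (firstDigit x) * z (firstDigit x - 1) = q at *
  constructor <;> by_contra! h <;> nlinarith

lemma firstDigit_eq_of_mem_Ico (hn : 2 ≤ n) (hx : x ∈ Ico (z n) (z (n - 1))) :
    firstDigit x = n := by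
  have h0 : 0 < x := (z_pos (by omega)).trans_le hx.1
  have h3 : (0 : ℝ) < ((n - 1 : ℕ) : ℝ) := by exact_mod_cast (by omega : 0 < n - 1)
  have h1 : x < 1 := by
    refine hx.2.trans_le ?_
    rw [z, div_le_one h3]
    exact_mod_cast (by omega : 1 ≤ n - 1)
  rw [firstDigit, if_neg h1.ne, Nat.ceil_eq_iff (by omega)]
  have h4 : (0 : ℝ) < n := by exact_mod_cast (by omega : 0 < n)
  exact ⟨(lt_div_comm₀ h0 h3).1 hx.2, (div_le_comm₀ h4 h0).1 hx.1⟩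

lemma zMinus_pred (hn : 2 ≤ n) :
    zMinus c (n - 1) = z n + (1 - c) * (z n * z (n - 1)) := by
  rw [zMinus, Nat.sub_add_cancel (by omega)]
  linear_combination -z_mul_z_pred hn

lemma zPlus_eq : zPlus c n = z n + c * (z n * z (n - 1)) := by
  rw [zPlus]; ring

/-- The digit intervals are disjoint, so only `n = firstDigit x` can contribute. This turns each
union defining the maps and signs into an inequality for `TL x`. -/
lemma exists_mem_iff (h0 : 0 < x) (h1 : x < 1) {I : ℕ → Set ℝ} {p : ℝ → Prop}
    (hI : ∀ n, 2 ≤ n → I n ⊆ Ico (z n) (z (n - 1)))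
    (hp : ∀ n t, 2 ≤ n → 0 ≤ t → t < 1 → (z n + t * (z n * z (n - 1)) ∈ I n ↔ p t)) :
    (∃ n, 2 ≤ n ∧ x ∈ I n) ↔ p (TL x) := by
  have key : x ∈ I (firstDigit x) ↔ p (TL x) := by
    rw [← hp _ _ (two_le_firstDigit h0 h1) (TL_mem_Ico h0 h1).1 (TL_mem_Ico h0 h1).2,
      ← eq_z_add_TL h0 h1]
  rw [← key]
  constructor
  · rintro ⟨n, hn, hx⟩
    rwa [firstDigit_eq_of_mem_Ico hn (hI n hn hx)]
  · exact fun h => ⟨_, two_le_firstDigit h0 h1, h⟩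

lemma exists_mem_Ico_zPlus_iff (hc : c ≤ 1 / 2) (h0 : 0 < x) (h1 : x < 1) :
    (∃ n : ℕ, 2 ≤ n ∧ x ∈ Ico (z n) (zPlus c n)) ↔ TL x < c := by
  refine exists_mem_iff h0 h1 (p := fun t => t < c) (fun n hn y hy => ⟨hy.1, hy.2.trans_le ?_⟩)
    (fun n t hn ht0 ht1 => ?_)
  · rw [zPlus_eq]; nlinarith [z_mul_z_pred hn, z_mul_z_pred_pos hn]
  · have := z_mul_z_pred_pos hn
    rw [mem_Ico, zPlus_eq, add_lt_add_iff_left, mul_lt_mul_iff_left₀ this]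
    exact ⟨fun h => h.2, fun h => ⟨by nlinarith, h⟩⟩

lemma exists_mem_Icc_zMinus_iff (hc0 : 0 < c) (h0 : 0 < x) (h1 : x < 1) :
    (∃ n : ℕ, 2 ≤ n ∧ x ∈ Icc (z n) (zMinus c (n - 1))) ↔ TL x ≤ 1 - c := by
  refine exists_mem_iff h0 h1 (p := fun t => t ≤ 1 - c) (fun n hn y hy => ⟨hy.1, hy.2.trans_lt ?_⟩)
    (fun n t hn ht0 ht1 => ?_)
  · rw [zMinus_pred hn]; nlinarith [z_mul_z_pred hn, z_mul_z_pred_pos hn]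
  · have := z_mul_z_pred_pos hn
    rw [mem_Icc, zMinus_pred hn, add_le_add_iff_left, mul_le_mul_iff_left₀ this]
    exact ⟨fun h => h.2, fun h => ⟨by nlinarith, h⟩⟩

lemma exists_mem_Icc_switch_iff (hc0 : 0 < c) (h0 : 0 < x) (h1 : x < 1) :
    (∃ n : ℕ, 2 ≤ n ∧ x ∈ Icc (zPlus c n) (zMinus c (n - 1))) ↔ c ≤ TL x ∧ TL x ≤ 1 - c := by
  refine exists_mem_iff h0 h1 (p := fun t => c ≤ t ∧ t ≤ 1 - c)
    (fun n hn y hy => ⟨le_trans ?_ hy.1, hy.2.trans_lt ?_⟩) (fun n t hn ht0 ht1 => ?_)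
  · rw [zPlus_eq]; nlinarith [z_mul_z_pred_pos hn]
  · rw [zMinus_pred hn]; nlinarith [z_mul_z_pred hn, z_mul_z_pred_pos hn]
  · have := z_mul_z_pred_pos hn
    rw [mem_Icc, zMinus_pred hn, zPlus_eq, add_le_add_iff_left, add_le_add_iff_left,
      mul_le_mul_iff_left₀ this, mul_le_mul_iff_left₀ this]

lemma mem_switchRegion_iff (hc0 : 0 < c) (hx : x ∈ Icc c 1) (h1 : x < 1) :
    x ∈ switchRegion c ↔ c ≤ TL x ∧ TL x ≤ 1 - c := by
  rw [← exists_mem_Icc_switch_iff hc0 (hc0.trans_le hx.1) h1]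
  exact and_iff_right hx

lemma exists_mem_Ioo_zMinus_iff (hc : c ≤ 1 / 2) (h0 : 0 < x) (h1 : x < 1) :
    (∃ n : ℕ, 1 ≤ n ∧ x ∈ Ioo (zMinus c n) (z n)) ↔ 1 - c < TL x := by
  -- The index is shifted because the gap just below `z (n - 1)` lies in the interval of digit `n`.
  have := exists_mem_iff h0 h1 (I := fun n => Ioo (zMinus c (n - 1)) (z (n - 1)))
    (p := fun t => 1 - c < t) (fun n hn y hy => ⟨le_trans ?_ hy.1.le, hy.2⟩)
    (fun n t hn ht0 ht1 => ?_)
  · rw [← this]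
    constructor
    · rintro ⟨n, hn, h⟩
      exact ⟨n + 1, by omega, h⟩
    · rintro ⟨n, hn, h⟩
      exact ⟨n - 1, by omega, h⟩
  · rw [zMinus_pred hn]; nlinarith [z_mul_z_pred hn, z_mul_z_pred_pos hn]
  · have h := z_mul_z_pred_pos hn
    rw [mem_Ioo, zMinus_pred hn, add_lt_add_iff_left, mul_lt_mul_iff_left₀ h]
    exact ⟨fun h => h.1, fun h => ⟨h, by nlinarith [z_mul_z_pred hn]⟩⟩

lemma T_zero (hc : c ≤ 1 / 2) (h0 : 0 < x) (h1 : x < 1) :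
    T c 0 x = if TL x < c then 1 - TL x else TL x := by
  have := exists_mem_Ico_zPlus_iff hc h0 h1
  simp only [T, if_true, T0, TA, h0.ne', false_or, this]

lemma T_one (hc0 : 0 < c) (h0 : 0 < x) (h1 : x < 1) :
    T c 1 x = if TL x ≤ 1 - c then 1 - TL x else TL x := by
  have := exists_mem_Icc_zMinus_iff hc0 h0 h1
  simp only [T, one_ne_zero, if_false, T1, TA, h0.ne', false_or, this]

lemma firstSign_eq (hc0 : 0 < c) (hc : c ≤ 1 / 2) (hx : x ∈ Icc c 1) (h1 : x < 1)
    (ω : ℕ → Fin 2) :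
    firstSign c (ω, x) = if ((c ≤ TL x ∧ TL x ≤ 1 - c) ∧ ω 0 = 0) ∨ 1 - c < TL x then 0 else 1 := by
  have h0 := hc0.trans_le hx.1
  simp only [firstSign, mem_switchRegion_iff hc0 hx h1, exists_mem_Ioo_zMinus_iff hc h0 h1, h1.ne,
    or_false]

/-! ### Inverse branches -/

/-- The inverse branch of the random map with sign `t.1` and digit `t.2`. -/
noncomputable def branch (t : Fin 2 × ℕ) (y : ℝ) : ℝ :=
  ((t.2 : ℝ) - 1 + ((t.1 : ℕ) : ℝ)) / ((t.2 : ℝ) * ((t.2 : ℝ) - 1)) +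
    (-1) ^ (t.1 : ℕ) * y / ((t.2 : ℝ) * ((t.2 : ℝ) - 1))

lemma branch_zero (hn : 2 ≤ n) : branch (0, n) y = z n + y * (z n * z (n - 1)) := by
  obtain ⟨m, rfl⟩ := Nat.exists_eq_add_of_le hn
  simp only [branch, z, show 2 + m - 1 = m + 1 by omega]
  have h : (2 + m - 1 : ℝ) ≠ 0 := by
    have : (0 : ℝ) ≤ m := by positivity
    linarith
  push_cast
  simp only [Fin.isValue, Fin.val_zero, CharP.cast_eq_zero, add_zero, pow_zero, one_mul]
  rw [show (2 + m - 1 : ℝ) = m + 1 by ring]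
  field_simp

lemma branch_one (hn : 2 ≤ n) : branch (1, n) y = z n + (1 - y) * (z n * z (n - 1)) := by
  obtain ⟨m, rfl⟩ := Nat.exists_eq_add_of_le hn
  simp only [branch, z, show 2 + m - 1 = m + 1 by omega]
  push_cast
  simp only [Fin.isValue, Fin.val_one, Nat.cast_one, pow_one]
  rw [show (2 + m - 1 : ℝ) = m + 1 by ring]
  field_simp
  ring

lemma irrational_branch_iff {t : Fin 2 × ℕ} (ht : 2 ≤ t.2) :
    Irrational (branch t y) ↔ Irrational y := by
  have h1 : (t.2 : ℝ) - 1 ≠ 0 := by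
    have : (2 : ℝ) ≤ t.2 := by exact_mod_cast ht
    linarith
  have h2 : (t.2 : ℝ) ≠ 0 := by
    have : (2 : ℝ) ≤ t.2 := by exact_mod_cast ht
    linarith
  have h3 : ((-1 : ℝ) ^ (t.1 : ℕ)) * (-1 : ℝ) ^ (t.1 : ℕ) = 1 := by
    rw [← mul_pow]; norm_num
  rw [← not_iff_not, Irrational, Irrational, not_not, not_not]
  constructor
  · rintro ⟨q, hq⟩
    refine ⟨(-1) ^ (t.1 : ℕ) * (q * (t.2 * (t.2 - 1)) - (t.2 - 1 + (t.1 : ℕ))), ?_⟩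
    push_cast
    rw [hq, branch]
    field_simp
    linear_combination y * h3
  · rintro ⟨q, rfl⟩
    refine ⟨((t.2 : ℚ) - 1 + ((t.1 : ℕ) : ℚ)) / ((t.2 : ℚ) * ((t.2 : ℚ) - 1)) +
      (-1) ^ (t.1 : ℕ) * q / ((t.2 : ℚ) * ((t.2 : ℚ) - 1)), ?_⟩
    push_cast
    rfl

lemma lt_one_of_irrational (hx : x ∈ Icc c 1) (hi : Irrational x) : x < 1 :=
  lt_of_le_of_ne hx.2 hi.ne_one

/-- One step of the random map is inverted by the branch of its sign and digit. -/
lemma branch_T (hc0 : 0 < c) (hc : c ≤ 1 / 2) (hx : x ∈ Icc c 1) (hi : Irrational x)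
    (ω : ℕ → Fin 2) :
    branch (firstSign c (ω, x), firstDigit x) (T c (ω 0) x) = x ∧ T c (ω 0) x ∈ Icc c 1 := by
  have h1 := lt_one_of_irrational hx hi
  have h0 := hc0.trans_le hx.1
  have h2 := two_le_firstDigit h0 h1
  have h3 := eq_z_add_TL h0 h1
  obtain ⟨h4, h5⟩ := TL_mem_Ico h0 h1
  have hω : ω 0 = 0 ∨ ω 0 = 1 := by
    generalize ω 0 = j
    fin_cases j <;> simp
  rw [firstSign_eq hc0 hc hx h1]
  rcases hω with hω | hω <;> simp only [hω, T_zero hc h0 h1, T_one hc0 h0 h1, one_ne_zero,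
    and_false, false_or, and_true]
  · by_cases h : TL x < c
    · rw [if_neg (by rintro (h' | h') <;> [linarith [h'.1]; linarith]), if_pos h, branch_one h2, sub_sub_cancel]
      exact ⟨h3.symm, by linarith, by linarith⟩
    · rw [if_pos (by by_contra! h'; linarith [h'.1 (not_lt.1 h)]), if_neg h, branch_zero h2]
      exact ⟨h3.symm, by linarith, by linarith⟩
  · by_cases h : TL x ≤ 1 - c
    · rw [if_neg (by linarith), if_pos h, branch_one h2, sub_sub_cancel]
      exact ⟨h3.symm, by linarith, by linarith⟩
    · rw [if_pos (by linarith), if_neg h, branch_zero h2]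
      exact ⟨h3.symm, by linarith, by linarith⟩

/-- Every branch is full: it is an inverse branch of the random map on all irrational points. -/
lemma T_branch (hc0 : 0 < c) (hc : c ≤ 1 / 2) (hy : y ∈ Icc c 1) (hi : Irrational y)
    {t : Fin 2 × ℕ} (ht : 2 ≤ t.2) (htc : c ≤ z t.2) {ω : ℕ → Fin 2} (hω : ω 0 = t.1) :
    branch t y ∈ Icc c 1 ∧ T c (ω 0) (branch t y) = y ∧
      (firstSign c (ω, branch t y), firstDigit (branch t y)) = t := by
  obtain ⟨s, n⟩ := t
  simp only at ht htc hω
  have h1 := lt_one_of_irrational hy hi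
  obtain ⟨u, hu0, hu1, hu⟩ : ∃ u, 0 ≤ u ∧ u < 1 ∧ branch (s, n) y = z n + u * (z n * z (n - 1)) := by
    fin_cases s
    · exact ⟨y, hc0.le.trans hy.1, h1, branch_zero ht⟩
    · exact ⟨1 - y, by linarith, by linarith [hy.1], branch_one ht⟩
  have hp := z_mul_z_pred_pos ht
  have hz : z (n - 1) ≤ 1 := by
    have h3 : (0 : ℝ) < ((n - 1 : ℕ) : ℝ) := by exact_mod_cast (by omega : 0 < n - 1)
    rw [z, div_le_one h3]
    exact_mod_cast (by omega : 1 ≤ n - 1)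
  have hmem : branch (s, n) y ∈ Ico (z n) (z (n - 1)) := by
    rw [hu]
    constructor <;> nlinarith [z_mul_z_pred ht]
  have hb1 : branch (s, n) y < 1 := hmem.2.trans_le hz
  have hbc : branch (s, n) y ∈ Icc c 1 := ⟨htc.trans hmem.1, hb1.le⟩
  have hb0 := hc0.trans_le hbc.1
  have hd := firstDigit_eq_of_mem_Ico ht hmem
  have hTL : TL (branch (s, n) y) = u := by
    have h := eq_z_add_TL hb0 hb1
    rw [hd, hu] at h
    rw [hu]
    exact (mul_right_cancel₀ hp.ne' (add_left_cancel h)).symm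
  refine ⟨hbc, ?_, ?_⟩
  -- As `y ≥ c`, the coordinate `u` is `y ≥ c` for sign 0 and `1 - y ≤ 1 - c` for sign 1, which is
  -- where the symbol `s` selects the branch of sign `s`.
  · fin_cases s
    · simp only [Fin.zero_eta] at *
      have : u = y := by
        rw [branch_zero ht] at hu
        exact (mul_right_cancel₀ hp.ne' (add_left_cancel hu)).symm
      rw [hω, T_zero hc hb0 hb1, hTL, this, if_neg (not_lt.2 hy.1)]
    · simp only [Fin.mk_one] at *
      have : u = 1 - y := by
        rw [branch_one ht] at hu
        exact (mul_right_cancel₀ hp.ne' (add_left_cancel hu)).symm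
      rw [hω, T_one hc0 hb0 hb1, hTL, this, if_pos (by linarith [hy.1]), sub_sub_cancel]
  · rw [hd, firstSign_eq hc0 hc hbc hb1, hTL]
    congr 1
    fin_cases s
    · simp only [Fin.zero_eta] at *
      have : u = y := by
        rw [branch_zero ht] at hu
        exact (mul_right_cancel₀ hp.ne' (add_left_cancel hu)).symm
      rw [if_pos]
      by_contra! h
      have := h.1
      rw [hω] at this
      exact this ⟨by rw [‹u = y›]; exact hy.1, h.2⟩ rfl
    · simp only [Fin.mk_one] at *
      have : u = 1 - y := by
        rw [branch_one ht] at hu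
        exact (mul_right_cancel₀ hp.ne' (add_left_cancel hu)).symm
      rw [if_neg]
      rintro (h | h)
      · rw [hω] at h; exact one_ne_zero h.2
      · linarith [hy.1]

/-! ### Orbits and the expansions they generate -/

lemma iterate_L_fst (q : (ℕ → Fin 2) × ℝ) (n m : ℕ) : ((L c)^[n] q).1 m = q.1 (n + m) := by
  induction n generalizing q with
  | zero => simp
  | succ n ih =>
    rw [Function.iterate_succ_apply, ih]
    exact congrArg q.1 (by omega)

lemma iterate_L_succ_snd (q : (ℕ → Fin 2) × ℝ) (n : ℕ) :
    ((L c)^[n + 1] q).2 = T c (q.1 n) ((L c)^[n] q).2 := by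
  rw [Function.iterate_succ_apply', L, iterate_L_fst]
  rfl

lemma iterate_L_snd_congr {ω ω' : ℕ → Fin 2} (h : ∀ k < n, ω k = ω' k) :
    ((L c)^[n] (ω, x)).2 = ((L c)^[n] (ω', x)).2 := by
  induction n with
  | zero => rfl
  | succ n ih =>
    rw [iterate_L_succ_snd, iterate_L_succ_snd, ih fun k hk => h k (by omega)]
    simp only [h n (by omega)]

lemma firstSign_congr {q q' : (ℕ → Fin 2) × ℝ} (h : q.1 0 = q'.1 0) (h' : q.2 = q'.2) :
    firstSign c q = firstSign c q' := by
  rw [firstSign, firstSign]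
  congr 1
  rw [h, h']

lemma signDigitSeq_congr {ω ω' : ℕ → Fin 2} (h : ∀ k < n + 1, ω k = ω' k) :
    signDigitSeq c ω x n = signDigitSeq c ω' x n := by
  have h1 : ((L c)^[n] (ω, x)).2 = ((L c)^[n] (ω', x)).2 :=
    iterate_L_snd_congr fun k hk => h k (by omega)
  have h2 : ((L c)^[n] (ω, x)).1 0 = ((L c)^[n] (ω', x)).1 0 := by
    rw [iterate_L_fst, iterate_L_fst]
    exact h n (by omega)
  rw [signDigitSeq, signDigitSeq, h1, firstSign_congr h2 h1]

lemma signDigitSeq_add {ω ω' : ℕ → Fin 2} (h : (L c)^[n] (ω, x) = (ω', y)) (m : ℕ) :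
    signDigitSeq c ω x (n + m) = signDigitSeq c ω' y m := by
  rw [signDigitSeq, signDigitSeq, add_comm, Function.iterate_add_apply, h]

/-- Splicing: the point reached after `n` steps depends only on the first `n` symbols, so the
remaining symbols are free. -/
lemma exists_iterate_L_eq (c x : ℝ) (ω₀ ω' : ℕ → Fin 2) (n : ℕ) :
    ∃ ω, (∀ k < n, ω k = ω₀ k) ∧ (L c)^[n] (ω, x) = (ω', ((L c)^[n] (ω₀, x)).2) := by
  have hω : ∀ k < n, (fun k => if k < n then ω₀ k else ω' (k - n)) k = ω₀ k :=
    fun k hk => if_pos hk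
  refine ⟨fun k => if k < n then ω₀ k else ω' (k - n), hω,
    Prod.ext (funext fun m => ?_) (iterate_L_snd_congr hω)⟩
  rw [iterate_L_fst]
  simp

lemma iterate_L_mem (hc0 : 0 < c) (hc : c ≤ 1 / 2) (hx : x ∈ Icc c 1) (hi : Irrational x)
    (ω : ℕ → Fin 2) (n : ℕ) :
    ((L c)^[n] (ω, x)).2 ∈ Icc c 1 ∧ Irrational ((L c)^[n] (ω, x)).2 := by
  induction n with
  | zero => exact ⟨hx, hi⟩
  | succ n ih =>
    rw [iterate_L_succ_snd]
    obtain ⟨h1, h2⟩ := branch_T hc0 hc ih.1 ih.2 fun _ => ω n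
    refine ⟨h2, ?_⟩
    have h3 := ih.2
    rw [← h1, irrational_branch_iff] at h3
    · exact h3
    · exact two_le_firstDigit (hc0.trans_le ih.1.1) (lt_one_of_irrational ih.1 ih.2)

lemma branch_signDigitSeq (hc0 : 0 < c) (hc : c ≤ 1 / 2) (hx : x ∈ Icc c 1) (hi : Irrational x)
    (ω : ℕ → Fin 2) (n : ℕ) :
    2 ≤ (signDigitSeq c ω x n).2 ∧
    branch (signDigitSeq c ω x n) ((L c)^[n + 1] (ω, x)).2 = ((L c)^[n] (ω, x)).2 := by
  obtain ⟨h1, h2⟩ := iterate_L_mem hc0 hc hx hi ω n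
  refine ⟨two_le_firstDigit (hc0.trans_le h1.1) (lt_one_of_irrational h1 h2), ?_⟩
  have := (branch_T hc0 hc h1 h2 ((L c)^[n] (ω, x)).1).1
  rw [iterate_L_fst] at this
  rw [iterate_L_succ_snd]
  exact this

/-- The random map generates generalised Lüroth expansions. -/
lemma isGeneralisedLurothExpansion_signDigitSeq (hc0 : 0 < c) (hc : c ≤ 1 / 2) (hx : x ∈ Icc c 1)
    (hi : Irrational x) (ω : ℕ → Fin 2) :
    IsGeneralisedLurothExpansion (signDigitSeq c ω x) x := by
  have hb := branch_signDigitSeq hc0 hc hx hi ω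
  have hmem := fun n => (iterate_L_mem hc0 hc hx hi ω n).1
  generalize signDigitSeq c ω x = a at *
  generalize hu : (fun n => ((L c)^[n] (ω, x)).2) = u
  have hu0 : u 0 = x := by rw [← hu]; rfl
  replace hb : ∀ n, 2 ≤ (a n).2 ∧ branch (a n) (u (n + 1)) = u n := by rw [← hu]; exact hb
  replace hmem : ∀ n, u n ∈ Icc c 1 := by rw [← hu]; exact hmem
  clear hu
  refine ⟨fun n => (hb n).1, ?_⟩
  have hd2 : ∀ n, (2 : ℝ) ≤ (a n).2 := fun n => by exact_mod_cast (hb n).1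
  have hdd : ∀ n, (2 : ℝ) ≤ ((a n).2 : ℝ) * (((a n).2 : ℝ) - 1) := fun n => by nlinarith [hd2 n]
  have hprod : ∀ n, (2 : ℝ) ^ n ≤ ∏ i ∈ Finset.range n, (((a i).2 : ℝ) * (((a i).2 : ℝ) - 1)) := by
    intro n
    simpa using Finset.prod_le_prod (s := Finset.range n) (f := fun _ => (2 : ℝ)) (by simp)
      fun i _ => hdd i
  have hpos : ∀ n, 0 < ∏ i ∈ Finset.range n, (((a i).2 : ℝ) * (((a i).2 : ℝ) - 1)) :=
    fun n => lt_of_lt_of_le (by positivity) (hprod n)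
  have hsum : Summable fun n : ℕ => (-1 : ℝ) ^ (∑ i ∈ Finset.range n, ((a i).1 : ℕ)) *
      ((((a n).2 : ℝ) - 1 + (((a n).1 : ℕ) : ℝ)) /
        ∏ i ∈ Finset.range (n + 1), (((a i).2 : ℝ) * (((a i).2 : ℝ) - 1))) := by
    -- The numerator satisfies `d - 1 + s ≤ d ≤ d (d - 1)`, which cancels the last factor of the
    -- product.
    refine Summable.of_norm_bounded summable_geometric_two fun n => ?_
    have hs : (((a n).1 : ℕ) : ℝ) ≤ 1 := by exact_mod_cast (by omega : ((a n).1 : ℕ) ≤ 1)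
    have hs0 : (0 : ℝ) ≤ (((a n).1 : ℕ) : ℝ) := by positivity
    rw [norm_mul, norm_pow, norm_neg, norm_one, one_pow, one_mul, Real.norm_of_nonneg
      (div_nonneg (by linarith [hd2 n]) (hpos _).le), Finset.prod_range_succ, one_div, inv_pow,
      div_le_iff₀ (mul_pos (hpos n) (by linarith [hdd n]))]
    calc ((a n).2 : ℝ) - 1 + (((a n).1 : ℕ) : ℝ)
        ≤ 1 * (((a n).2 : ℝ) * (((a n).2 : ℝ) - 1)) := by nlinarith [hd2 n]
      _ ≤ ((2 ^ n)⁻¹ * ∏ i ∈ Finset.range n, (((a i).2 : ℝ) * (((a i).2 : ℝ) - 1))) *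
          (((a n).2 : ℝ) * (((a n).2 : ℝ) - 1)) := by
          refine mul_le_mul_of_nonneg_right ?_ (by linarith [hdd n])
          rw [inv_mul_eq_div, le_div_iff₀ (by positivity), one_mul]
          exact hprod n
      _ = _ := by ring
  rw [hsum.hasSum_iff_tendsto_nat]
  -- Iterating `branch` gives the exact remainder: the current orbit point, with sign, over the
  -- product.
  have hpartial : ∀ n, ∑ k ∈ Finset.range n, (-1 : ℝ) ^ (∑ i ∈ Finset.range k, ((a i).1 : ℕ)) *
      ((((a k).2 : ℝ) - 1 + (((a k).1 : ℕ) : ℝ)) /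
        ∏ i ∈ Finset.range (k + 1), (((a i).2 : ℝ) * (((a i).2 : ℝ) - 1))) =
      x - (-1 : ℝ) ^ (∑ i ∈ Finset.range n, ((a i).1 : ℕ)) *
        (u n / ∏ i ∈ Finset.range n, (((a i).2 : ℝ) * (((a i).2 : ℝ) - 1))) := by
    intro n
    induction n with
    | zero => simp [hu0]
    | succ n ih =>
      rw [Finset.sum_range_succ, ih, ← (hb n).2, branch, Finset.prod_range_succ,
        Finset.sum_range_succ, pow_add]
      have h1 := (hpos n).ne'
      have h2 : ((a n).2 : ℝ) ≠ 0 := by linarith [hd2 n]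
      have h3 : ((a n).2 : ℝ) - 1 ≠ 0 := by linarith [hd2 n]
      field_simp
      ring
  simp_rw [hpartial]
  have hlim : Tendsto (fun n => (-1 : ℝ) ^ (∑ i ∈ Finset.range n, ((a i).1 : ℕ)) *
        (u n / ∏ i ∈ Finset.range n, (((a i).2 : ℝ) * (((a i).2 : ℝ) - 1)))) atTop (𝓝 0) := by
    refine squeeze_zero_norm (fun n => ?_)
      (tendsto_pow_atTop_nhds_zero_of_lt_one (r := (1 / 2 : ℝ)) (by norm_num) (by norm_num))
    rw [norm_mul, norm_pow, norm_neg, norm_one, one_pow, one_mul, Real.norm_of_nonneg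
      (div_nonneg (hc0.le.trans (hmem n).1) (hpos _).le), one_div, inv_pow, ← one_div]
    exact div_le_div₀ zero_le_one (hmem n).2 (by positivity) (hprod n)
  simpa using tendsto_const_nhds.sub hlim

lemma signDigitSeq_mem_expansions (hc0 : 0 < c) (hc : c ≤ 1 / 2) (hx : x ∈ Icc c 1)
    (hi : Irrational x) (ω : ℕ → Fin 2) : signDigitSeq c ω x ∈ expansions c x :=
  ⟨isGeneralisedLurothExpansion_signDigitSeq hc0 hc hx hi ω, ω, rfl⟩

/-! ### Visits to the switch region -/

lemma not_forall_eq_two_mul {u : ℕ → ℝ} (h0 : 0 < u 0) (hb : ∀ n, u n ≤ 1)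
    (h : ∀ n, u (n + 1) = 2 * u n) : False := by
  have hu : ∀ n, u n = 2 ^ n * u 0 := by
    intro n
    induction n with
    | zero => simp
    | succ n ih => rw [h, ih]; ring
  obtain ⟨n, hn⟩ := pow_unbounded_of_one_lt (1 / u 0) one_lt_two
  rw [div_lt_iff₀ h0, ← hu] at hn
  exact hn.not_ge (hb n)

lemma TL_of_one_half_lt (h0 : 1 / 2 < x) (h1 : x < 1) : TL x = 2 * x - 1 := by
  have hd : firstDigit x = 2 := firstDigit_eq_of_mem_Ico le_rfl ⟨by norm_num [z]; linarith, by
    norm_num [z]; exact h1⟩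
  have := eq_z_add_TL (by linarith) h1
  rw [hd] at this
  norm_num [z] at this
  linarith

/-- Every irrational orbit of the random map enters the switch region. -/
lemma exists_iterate_mem_switchRegion (hc0 : 0 < c) (hc : c ≤ 2 / 5) (hx : x ∈ Icc c 1)
    (hi : Irrational x) (ω : ℕ → Fin 2) : ∃ n, ((L c)^[n] (ω, x)).2 ∈ switchRegion c := by
  by_contra! hS
  have hmem := iterate_L_mem hc0 (by linarith) hx hi ω
  have hstep := iterate_L_succ_snd (c := c) (ω, x)
  generalize hu : (fun n => ((L c)^[n] (ω, x)).2) = u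
  replace hS : ∀ n, u n ∉ switchRegion c := by rw [← hu]; exact hS
  replace hmem : ∀ n, u n ∈ Icc c 1 ∧ Irrational (u n) := by rw [← hu]; exact hmem
  replace hstep : ∀ n, u (n + 1) = T c (ω n) (u n) := by rw [← hu]; exact hstep
  clear hu
  have hlt := fun n => lt_one_of_irrational (hmem n).1 (hmem n).2
  have hpos := fun n => hc0.trans_le (hmem n).1.1
  -- Outside the switch region both choices act alike. The next point exceeds `1 - c > 1/2`, so from
  -- time 1 on every digit is 2 and the step is `u ↦ 2 - 2u` or `u ↦ 2u - 1`.
  have hcases : ∀ n, (TL (u n) < c ∧ u (n + 1) = 1 - TL (u n)) ∨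
      (1 - c < TL (u n) ∧ u (n + 1) = TL (u n)) := by
    intro n
    have h := hS n
    rw [mem_switchRegion_iff hc0 (hmem n).1 (hlt n), not_and_or, not_le, not_le] at h
    rw [hstep]
    generalize ω n = j
    rcases h with h | h <;> [left; right] <;> refine ⟨h, ?_⟩ <;> fin_cases j
    · simp [T_zero (c := c) (by linarith) (hpos n) (hlt n), h]
    · exact (T_one hc0 (hpos n) (hlt n)).trans (if_pos (by linarith))
    · exact (T_zero (by linarith) (hpos n) (hlt n)).trans (if_neg (by linarith))
    · exact (T_one hc0 (hpos n) (hlt n)).trans (if_neg (by linarith))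
  have hgt : ∀ n, 1 - c < u (n + 1) := by
    intro n
    rcases hcases n with ⟨h, h'⟩ | ⟨h, h'⟩ <;> linarith
  have hTL : ∀ n, TL (u (n + 1)) = 2 * u (n + 1) - 1 := fun n =>
    TL_of_one_half_lt (by linarith [hgt n]) (hlt _)
  by_cases hlow : ∃ n, TL (u (n + 1)) < c
  · obtain ⟨n, hn⟩ := hlow
    have hall : ∀ k, TL (u (n + k + 1)) < c := by
      intro k
      induction k with
      | zero => exact hn
      | succ k ih =>
        rcases hcases (n + (k + 1) + 1) with ⟨h, -⟩ | ⟨h, -⟩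
        · exact h
        · exfalso
          -- A low step followed by a high one would need `1 - c < u < 1/2 + c/4`, hence `c > 2/5`.
          -- So low steps persist.
          rcases hcases (n + k + 1) with ⟨h1, h2⟩ | ⟨h1, h2⟩
          · have h3 := hTL (n + k + 1)
            have h4 := hTL (n + k)
            have h5 := hgt (n + k)
            rw [show n + (k + 1) + 1 = n + k + 1 + 1 by ring] at h
            linarith
          · linarith
    -- `2/3` is the fixed point of `u ↦ 2 - 2u`; the distance to it doubles and is nonzero by
    -- irrationality.
    refine not_forall_eq_two_mul (u := fun k => |u (n + k + 1) - 2 / 3|) ?_ (fun k => ?_)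
      fun k => ?_
    · rw [abs_pos, sub_ne_zero]
      exact fun h => (hmem (n + 0 + 1)).2.ne_rat (2 / 3) (h.trans (by norm_num))
    · have h1 := hpos (n + k + 1)
      have h2 := hlt (n + k + 1)
      exact abs_le.2 ⟨by linarith, by linarith⟩
    · have h1 := hall k
      have h3 := hTL (n + k)
      rcases hcases (n + k + 1) with ⟨-, h2⟩ | ⟨h2, -⟩
      · simp only [show n + (k + 1) + 1 = n + k + 1 + 1 by ring]
        rw [h2, h3, show 1 - (2 * u (n + k + 1) - 1) - 2 / 3 = -2 * (u (n + k + 1) - 2 / 3) by ring,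
          abs_mul]
        norm_num
      · linarith
  · push Not at hlow
    -- Only high steps remain, and these double the distance to the fixed point 1.
    refine not_forall_eq_two_mul (u := fun k => 1 - u (k + 1)) ?_ (fun k => ?_) fun k => ?_
    · linarith [hlt (0 + 1)]
    · linarith [hpos (k + 1)]
    · rcases hcases (k + 1) with ⟨h, -⟩ | ⟨-, h⟩
      · linarith [hlow k]
      · simp only [h, hTL k]; ring

/-! ### Baire category in the space of choices -/

lemma continuous_signDigitSeq (c x : ℝ) : Continuous fun ω => signDigitSeq c ω x := by
  refine continuous_pi fun n => ?_
  -- Entry `n` factors through the first `n + 1` symbols, a finite discrete space; the padding by 0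
  -- is never read.
  let e : (Fin (n + 1) → Fin 2) → ℕ → Fin 2 := fun v k => if h : k < n + 1 then v ⟨k, h⟩ else 0
  have h : (fun ω => signDigitSeq c ω x n) =
      (fun v => signDigitSeq c (e v) x n) ∘ fun ω i => ω (i : Fin (n + 1)) := by
    funext ω
    refine signDigitSeq_congr fun k hk => ?_
    rw [show e (fun i => ω i) k = ω k from dif_pos hk]
  rw [h]
  exact continuous_of_discreteTopology.comp (continuous_pi fun i => continuous_apply _)

lemma dense_of_forall_exists_prefix {U : Set (ℕ → Fin 2)}
    (h : ∀ (ω₀ : ℕ → Fin 2) (n : ℕ), ∃ ω ∈ U, ∀ k < n, ω k = ω₀ k) : Dense U := by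
  intro ω₀
  choose f hf hf' using h ω₀
  refine mem_closure_of_tendsto (f := f) (b := atTop) (tendsto_pi_nhds.2 fun k => ?_)
    (Eventually.of_forall hf)
  refine tendsto_const_nhds.congr' ?_
  filter_upwards [eventually_gt_atTop k] with n hn using (hf' n k hn).symm

/-- After any prefix the orbit meets the switch region again, and there the sign can be chosen
opposite to that of `a`. -/
lemma dense_signDigitSeq_ne (hc0 : 0 < c) (hc : c ≤ 2 / 5) (hx : x ∈ Icc c 1)
    (hi : Irrational x) (a : ℕ → Fin 2 × ℕ) : Dense {ω | signDigitSeq c ω x ≠ a} := by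
  refine dense_of_forall_exists_prefix fun ω₀ n => ?_
  have hmem := iterate_L_mem hc0 (by linarith) hx hi ω₀
  obtain ⟨m, hm⟩ : ∃ m, ((L c)^[n + m] (ω₀, x)).2 ∈ switchRegion c := by
    obtain ⟨m, hm⟩ := exists_iterate_mem_switchRegion hc0 hc (hmem n).1 (hmem n).2
      ((L c)^[n] (ω₀, x)).1
    refine ⟨m, ?_⟩
    rwa [add_comm, Function.iterate_add_apply]
  obtain ⟨hy, hyi⟩ := hmem (n + m)
  set y := ((L c)^[n + m] (ω₀, x)).2
  rw [mem_switchRegion_iff hc0 hy (lt_one_of_irrational hy hyi)] at hm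
  have hsign : ∀ j, ∃ ω, (∀ k < n + m, ω k = ω₀ k) ∧ (signDigitSeq c ω x (n + m)).1 = j := by
    intro j
    obtain ⟨ω, hω, h⟩ := exists_iterate_L_eq c x ω₀ (fun _ => j) (n + m)
    refine ⟨ω, hω, ?_⟩
    have := signDigitSeq_add h 0
    rw [add_zero] at this
    rw [this]
    refine (firstSign_eq hc0 (by linarith) hy (lt_one_of_irrational hy hyi) _).trans ?_
    have h3 : ¬ 1 - c < TL y := not_lt.2 hm.2
    fin_cases j <;> simp [hm, h3]
  obtain ⟨ω, hω, h⟩ := hsign (1 - (a (n + m)).1)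
  refine ⟨ω, fun heq => ?_, fun k hk => hω k (by omega)⟩
  rw [heq] at h
  generalize (a (n + m)).1 = j at h
  fin_cases j <;> simp at h

/-- By Baire's theorem, generically many choices generate uncountably many expansions. -/
lemma not_countable_of_forall_signDigitSeq_mem (hc0 : 0 < c) (hc : c ≤ 2 / 5) (hx : x ∈ Icc c 1)
    (hi : Irrational x) {ι : Type*} [Countable ι] {U : ι → Set (ℕ → Fin 2)}
    (ho : ∀ i, IsOpen (U i)) (hd : ∀ i, Dense (U i)) {A : Set (ℕ → Fin 2 × ℕ)}
    (hA : ∀ ω, (∀ i, ω ∈ U i) → signDigitSeq c ω x ∈ A) : ¬ A.Countable := by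
  intro hcount
  have := hcount.to_subtype
  -- An `ω` in this intersection generates an element of `A` that differs from every element of `A`.
  have hdense : Dense (⋂ i : ι ⊕ A,
      Sum.elim U (fun a : A => {ω | signDigitSeq c ω x ≠ a}) i) := by
    refine dense_iInter_of_isOpen ?_ ?_
    · rintro (i | a)
      · exact ho i
      · exact isClosed_singleton.isOpen_compl.preimage (continuous_signDigitSeq c x)
    · rintro (i | a)
      · exact hd i
      · exact dense_signDigitSeq_ne hc0 hc hx hi a
  obtain ⟨ω, hω⟩ := hdense.nonempty
  rw [mem_iInter] at hω
  exact hω (Sum.inr ⟨_, hA ω fun i => hω (Sum.inl i)⟩) rfl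

/-! ### Compositions of branches along finite blocks -/

variable {l : List (Fin 2 × ℕ)}

lemma branch_mem_Icc {t : Fin 2 × ℕ} (ht : 2 ≤ t.2) (htc : c ≤ z t.2) (hy : y ∈ Icc (0 : ℝ) 1) :
    branch t y ∈ Icc c 1 := by
  obtain ⟨s, n⟩ := t
  simp only at ht htc
  obtain ⟨u, hu0, hu1, hu⟩ : ∃ u, 0 ≤ u ∧ u ≤ 1 ∧ branch (s, n) y = z n + u * (z n * z (n - 1)) := by
    fin_cases s
    · exact ⟨y, hy.1, hy.2, branch_zero ht⟩
    · exact ⟨1 - y, by linarith [hy.2], by linarith [hy.1], branch_one ht⟩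
  have hz : z (n - 1) ≤ 1 := by
    have h3 : (0 : ℝ) < ((n - 1 : ℕ) : ℝ) := by exact_mod_cast (by omega : 0 < n - 1)
    rw [z, div_le_one h3]
    exact_mod_cast (by omega : 1 ≤ n - 1)
  rw [hu]
  constructor <;> nlinarith [z_mul_z_pred ht, z_mul_z_pred_pos ht]

lemma foldr_branch_mem_Icc (hc0 : 0 < c) (hl : ∀ t ∈ l, 2 ≤ t.2 ∧ c ≤ z t.2)
    (hy : y ∈ Icc c 1) : l.foldr branch y ∈ Icc c 1 := by
  induction l with
  | nil => exact hy
  | cons t l ih =>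
    have h := ih fun s hs => hl s (List.mem_cons_of_mem _ hs)
    exact branch_mem_Icc (hl t List.mem_cons_self).1 (hl t List.mem_cons_self).2
      ⟨hc0.le.trans h.1, h.2⟩

lemma irrational_foldr_branch_iff (hl : ∀ t ∈ l, 2 ≤ t.2) :
    Irrational (l.foldr branch y) ↔ Irrational y := by
  induction l with
  | nil => rfl
  | cons t l ih =>
    rw [List.foldr_cons, irrational_branch_iff (hl t List.mem_cons_self),
      ih fun s hs => hl s (List.mem_cons_of_mem _ hs)]

lemma exists_foldr_branch_sub (hl : ∀ t ∈ l, 2 ≤ t.2) :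
    ∃ b : ℝ, b ≠ 0 ∧ |b| ≤ (1 / 2) ^ l.length ∧
      ∀ y y', l.foldr branch y' - l.foldr branch y = b * (y' - y) := by
  induction l with
  | nil => exact ⟨1, one_ne_zero, by simp, fun y y' => by simp⟩
  | cons t l ih =>
    obtain ⟨b, hb0, hb, h⟩ := ih fun s hs => hl s (List.mem_cons_of_mem _ hs)
    have h2 : (2 : ℝ) ≤ t.2 := by exact_mod_cast hl t List.mem_cons_self
    have h3 : (2 : ℝ) ≤ (t.2 : ℝ) * ((t.2 : ℝ) - 1) := by nlinarith
    refine ⟨(-1) ^ (t.1 : ℕ) / ((t.2 : ℝ) * ((t.2 : ℝ) - 1)) * b, ?_, ?_, fun y y' => ?_⟩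
    · exact mul_ne_zero (div_ne_zero (pow_ne_zero _ (by norm_num)) (by linarith)) hb0
    · rw [abs_mul, abs_div, abs_pow, abs_neg, abs_one, one_pow, abs_of_nonneg (by linarith),
        List.length_cons, pow_succ']
      exact mul_le_mul (one_div_le_one_div_of_le two_pos h3) hb (abs_nonneg _) (by norm_num)
    · rw [List.foldr_cons, List.foldr_cons, mul_assoc, ← h, branch, branch]
      ring

/-- Every finite block is realised by the random map on the image of the corresponding branch. -/
lemma exists_iterate_L_foldr_branch (hc0 : 0 < c) (hc : c ≤ 1 / 2)
    (hl : ∀ t ∈ l, 2 ≤ t.2 ∧ c ≤ z t.2) (hy : y ∈ Icc c 1) (hi : Irrational y) :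
    ∃ ω, ∀ (i : ℕ) (h : i < l.length), signDigitSeq c ω (l.foldr branch y) i = l[i] := by
  induction l with
  | nil => exact ⟨0, fun i h => absurd h (by simp)⟩
  | cons t l ih =>
    have hl' : ∀ s ∈ l, 2 ≤ s.2 ∧ c ≤ z s.2 := fun s hs => hl s (List.mem_cons_of_mem _ hs)
    obtain ⟨ω, hω⟩ := ih hl'
    have h1 := foldr_branch_mem_Icc hc0 hl' hy
    have h2 := (irrational_foldr_branch_iff fun s hs => (hl' s hs).1).2 hi
    obtain ⟨ht, htc⟩ := hl t List.mem_cons_self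
    -- `ω'` is `ω` with the symbol `t.1` put in front.
    obtain ⟨ω', hω', hL⟩ := exists_iterate_L_eq c (branch t (l.foldr branch y)) (fun _ => t.1) ω 1
    obtain ⟨-, hT, hs⟩ := T_branch hc0 hc h1 h2 ht htc (hω' 0 one_pos)
    refine ⟨ω', fun i hi => ?_⟩
    rw [List.foldr_cons]
    cases i with
    | zero => exact hs
    | succ i =>
      have hL' : (L c)^[1] (ω', branch t (l.foldr branch y)) = (ω, l.foldr branch y) := by
        rw [hL]
        refine Prod.ext rfl ((?_ : _ = T c (ω' 0) (branch t (l.foldr branch y))).trans hT)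
        simp only [Function.iterate_one, L, hω' 0 one_pos]
      have hadd := signDigitSeq_add hL' i
      rw [Nat.add_comm 1 i] at hadd
      rw [hadd]
      simpa using hω i (by simpa using hi)

/-- Every point is the image of its `n`-th iterate under the branch of its first `n` digits. -/
lemma exists_foldr_branch_iterate_L_eq (hc0 : 0 < c) (hc : c ≤ 1 / 2) (hx : x ∈ Icc c 1)
    (hi : Irrational x) {p : Fin 2 × ℕ → Prop} (ω : ℕ → Fin 2)
    (hp : ∀ n, p (signDigitSeq c ω x n)) (n : ℕ) :
    ∃ l : List (Fin 2 × ℕ), l.length = n ∧ (∀ t ∈ l, 2 ≤ t.2 ∧ p t) ∧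
      l.foldr branch ((L c)^[n] (ω, x)).2 = x := by
  induction n with
  | zero => exact ⟨[], rfl, by simp, rfl⟩
  | succ n ih =>
    obtain ⟨l, hl, hl', h⟩ := ih
    obtain ⟨h1, h2⟩ := branch_signDigitSeq hc0 hc hx hi ω n
    refine ⟨l ++ [signDigitSeq c ω x n], by simp [hl], ?_, ?_⟩
    · simp only [List.mem_append, List.mem_singleton]
      rintro t (ht | rfl)
      exacts [hl' t ht, ⟨h1, hp n⟩]
    · rw [List.foldr_append, List.foldr_cons, List.foldr_nil, h2, h]

/-! ### Points avoiding a block form a null set -/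

/-- The points none of whose expansions contains the block `w`. -/
def avoiding (c : ℝ) (w : List (Fin 2 × ℕ)) : Set ℝ :=
  {x | x ∈ Icc c 1 ∧ Irrational x ∧ ∀ (ω : ℕ → Fin 2) (k : ℕ),
    ¬ ∀ (i : ℕ) (h : i < w.length), signDigitSeq c ω x (k + i) = w[i]}

/-- Holes of proportion `κ` at arbitrarily small scales keep the density of `s` at most `1 - κ`
along a sequence of radii, whereas almost every point of `s` has density 1. Measurability of `s` is
not required. -/
lemma volume_eq_zero_of_not_density {s : Set ℝ} {κ : ℝ} (hκ : 0 < κ)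
    (h : ∀ x ∈ s, ∀ ε > 0, ∃ r, 0 < r ∧ r < ε ∧ ∃ y,
      Metric.closedBall y (r * κ) ⊆ Metric.closedBall x r ∧
        Disjoint s (Metric.closedBall y (r * κ))) :
    volume s = 0 := by
  have hae := Besicovitch.ae_tendsto_measure_inter_div (volume : Measure ℝ) s
  rw [← Measure.restrict_apply_self]
  refine measure_mono_null (fun x hx => ?_) hae
  intro hlim
  choose r hr0 hr y hy hdis using fun n : ℕ => h x hx (1 / ((n : ℝ) + 1)) (by positivity)
  have hr' : Tendsto r atTop (𝓝[>] 0) := tendsto_nhdsWithin_iff.2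
    ⟨squeeze_zero (fun n => (hr0 n).le) (fun n => (hr n).le) tendsto_one_div_add_atTop_nhds_zero_nat,
      Eventually.of_forall hr0⟩
  have hle : (1 : ENNReal) ≤ ENNReal.ofReal (1 - κ) := by
    refine le_of_tendsto' (hlim.comp hr') fun n => ?_
    have h0 := hr0 n
    have hsub : s ∩ Metric.closedBall x (r n) ⊆
        Metric.closedBall x (r n) \ Metric.closedBall (y n) (r n * κ) :=
      fun p hp => ⟨hp.2, fun hp' => disjoint_left.1 (hdis n) hp.1 hp'⟩
    refine ENNReal.div_le_of_le_mul ((measure_mono hsub).trans ?_)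
    rw [measure_sdiff (hy n) measurableSet_closedBall.nullMeasurableSet
      measure_closedBall_lt_top.ne, Real.volume_closedBall, Real.volume_closedBall,
      ← ENNReal.ofReal_sub _ (by positivity), ← ENNReal.ofReal_mul' (by positivity)]
    exact ENNReal.ofReal_le_ofReal (by nlinarith)
  rw [← ENNReal.ofReal_one, ENNReal.ofReal_le_ofReal_iff'] at hle
  rcases hle with hle | hle <;> linarith

variable {ℓ : ℕ}

lemma signDigitSeq_snd_le (hℓ : 3 ≤ ℓ) (hx : x ∈ Icc (z ℓ) 1) (hi : Irrational x)
    (ω : ℕ → Fin 2) (n : ℕ) : (signDigitSeq (z ℓ) ω x n).2 ≤ ℓ := by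
  have hz : 0 < z ℓ := z_pos (by omega)
  have hz2 : z ℓ ≤ 1 / 2 := one_div_le_one_div_of_le two_pos (by exact_mod_cast (by omega : 2 ≤ ℓ))
  obtain ⟨h1, h2⟩ := iterate_L_mem hz hz2 hx hi ω n
  have h3 := lt_one_of_irrational h1 h2
  have h : (signDigitSeq (z ℓ) ω x n).2 = ⌈1 / ((L (z ℓ))^[n] (ω, x)).2⌉₊ := if_neg h3.ne
  rw [h, Nat.ceil_le, div_le_comm₀ (hz.trans_le h1.1) (by exact_mod_cast (by omega : 0 < ℓ))]
  exact h1.1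

lemma z_le_z {m n : ℕ} (hm : 2 ≤ m) (h : m ≤ n) : z n ≤ z m :=
  one_div_le_one_div_of_le (by exact_mod_cast (by omega : 0 < m)) (by exact_mod_cast h)

/-- By Lebesgue's density theorem, almost every point has an expansion containing a given block. -/
lemma volume_avoiding (hℓ : 3 ≤ ℓ) {w : List (Fin 2 × ℕ)} (hw : ∀ t ∈ w, 2 ≤ t.2 ∧ t.2 ≤ ℓ) :
    volume (avoiding (z ℓ) w) = 0 := by
  have hz : 0 < z ℓ := z_pos (by omega)
  have hz2 : z ℓ ≤ 1 / 2 := one_div_le_one_div_of_le two_pos (by exact_mod_cast (by omega : 2 ≤ ℓ))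
  have hle := fun x (hx : x ∈ Icc (z ℓ) 1) hi ω => signDigitSeq_snd_le (ω := ω) hℓ hx hi
  generalize hcz : z ℓ = c at *
  have hzc : ∀ m, 2 ≤ m → m ≤ ℓ → c ≤ z m := fun m h1 h2 => hcz ▸ z_le_z h1 h2
  obtain ⟨b, hb0, -, hb⟩ := exists_foldr_branch_sub fun t ht => (hw t ht).1
  -- `b` is the slope of the branch of `w`, and `(1 - c) / 2` is half the length of `[c, 1]`, whose
  -- midpoint `(c + 1) / 2` gives the centre of the hole.
  refine volume_eq_zero_of_not_density (κ := |b| * ((1 - c) / 2))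
    (mul_pos (abs_pos.2 hb0) (by linarith)) ?_
  rintro x ⟨hx, hi, hav⟩ ε hε
  obtain ⟨n, hn⟩ := exists_pow_lt_of_lt_one hε (show (1 / 2 : ℝ) < 1 by norm_num)
  -- Any `ω` would do here: only a small cylinder around `x` is needed.
  obtain ⟨l, hln, hl, hlx⟩ := exists_foldr_branch_iterate_L_eq hz hz2 hx hi (fun _ => 0)
    (p := fun t => t.2 ≤ ℓ) (hle x hx hi _) n
  have hu := (iterate_L_mem hz hz2 hx hi (fun _ => 0) n).1
  set u := ((L c)^[n] (fun _ => 0, x)).2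
  obtain ⟨r, hr0, hrn, hr⟩ := exists_foldr_branch_sub fun t ht => (hl t ht).1
  have hlw : ∀ t ∈ l ++ w, 2 ≤ t.2 ∧ c ≤ z t.2 := by
    intro t ht
    rcases List.mem_append.1 ht with h | h
    exacts [⟨(hl t h).1, hzc _ (hl t h).1 (hl t h).2⟩, ⟨(hw t h).1, hzc _ (hw t h).1 (hw t h).2⟩]
  have hsub : ∀ y y', (l ++ w).foldr branch y' - (l ++ w).foldr branch y = r * (b * (y' - y)) := by
    intro y y'
    rw [List.foldr_append, List.foldr_append, hr, hb]
  have hball : ∀ p ∈ Metric.closedBall ((l ++ w).foldr branch ((c + 1) / 2))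
      (|r| * (|b| * ((1 - c) / 2))), ∃ y ∈ Icc c 1, (l ++ w).foldr branch y = p := by
    intro p hp
    rw [Metric.mem_closedBall, Real.dist_eq] at hp
    have hy := hsub ((c + 1) / 2)
      ((c + 1) / 2 + (p - (l ++ w).foldr branch ((c + 1) / 2)) / (r * b))
    rw [add_sub_cancel_left, ← mul_assoc, mul_div_cancel₀ _ (mul_ne_zero hr0 hb0)] at hy
    refine ⟨_, ?_, sub_left_inj.1 hy⟩
    have : |(p - (l ++ w).foldr branch ((c + 1) / 2)) / (r * b)| ≤ (1 - c) / 2 := by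
      rw [abs_div, div_le_iff₀ (abs_pos.2 (mul_ne_zero hr0 hb0)), abs_mul]
      linarith
    have := abs_le.1 this
    constructor <;> linarith
  refine ⟨|r|, abs_pos.2 hr0, (hrn.trans_eq (by rw [hln])).trans_lt hn,
    (l ++ w).foldr branch ((c + 1) / 2), fun p hp => ?_, disjoint_left.2 ?_⟩
  · obtain ⟨y, hy, rfl⟩ := hball p hp
    have hwy : w.foldr branch y ∈ Icc c 1 :=
      foldr_branch_mem_Icc hz (fun t ht => hlw t (List.mem_append_right _ ht)) hy
    rw [Metric.mem_closedBall, Real.dist_eq, ← hlx, List.foldr_append, hr, abs_mul]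
    exact mul_le_of_le_one_right (abs_nonneg _)
      (abs_le.2 ⟨by linarith [hwy.1, hu.2], by linarith [hwy.2, hu.1]⟩)
  -- An irrational point of the hole realises `l ++ w`, so `w` occurs at position `l.length`.
  · rintro p ⟨-, hpi, hpav⟩ hp
    obtain ⟨y, hy, rfl⟩ := hball p hp
    rw [irrational_foldr_branch_iff fun t ht => (hlw t ht).1] at hpi
    obtain ⟨ω, hω⟩ := exists_iterate_L_foldr_branch hz hz2 hlw hy hpi
    refine hpav ω l.length fun i hi => ?_
    rw [hω _ (by simpa using hi)]
    simp

lemma volume_image_foldr_branch {s : Set ℝ} (hs : volume s = 0) (hl : ∀ t ∈ l, 2 ≤ t.2) :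
    volume (l.foldr branch '' s) = 0 := by
  obtain ⟨b, -, -, hb⟩ := exists_foldr_branch_sub hl
  refine addHaar_image_eq_zero_of_differentiableOn_of_addHaar_eq_zero volume
    (Differentiable.differentiableOn ?_) hs
  have : l.foldr branch = fun y => l.foldr branch 0 + b * (y - 0) :=
    funext fun y => by rw [← hb]; ring
  rw [this]
  fun_prop

/-! ### Universal expansions for almost every point -/

/-- There are uncountably many `ω`, but an iterate in `avoiding` puts `x` in the image of a null set
under one of countably many branch compositions. -/
lemma ae_forall_iterate_notMem_avoiding (hℓ : 3 ≤ ℓ) :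
    ∀ᵐ x : ℝ, x ∈ Icc (z ℓ) 1 → Irrational x → ∀ (w : List (Fin 2 × ℕ)),
      (∀ t ∈ w, 2 ≤ t.2 ∧ t.2 ≤ ℓ) → ∀ (ω : ℕ → Fin 2) (n : ℕ),
        ((L (z ℓ))^[n] (ω, x)).2 ∉ avoiding (z ℓ) w := by
  have hz : 0 < z ℓ := z_pos (by omega)
  have hz2 : z ℓ ≤ 1 / 2 := one_div_le_one_div_of_le two_pos (by exact_mod_cast (by omega : 2 ≤ ℓ))
  have key : ∀ᵐ x : ℝ, ∀ w l : List (Fin 2 × ℕ), (∀ t ∈ w, 2 ≤ t.2 ∧ t.2 ≤ ℓ) →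
      (∀ t ∈ l, 2 ≤ t.2) → x ∉ l.foldr branch '' avoiding (z ℓ) w := by
    refine ae_all_iff.2 fun w => ae_all_iff.2 fun l => ?_
    by_cases hw : ∀ t ∈ w, 2 ≤ t.2 ∧ t.2 ≤ ℓ
    · by_cases hl : ∀ t ∈ l, 2 ≤ t.2
      · filter_upwards [measure_eq_zero_iff_ae_notMem.1
          (volume_image_foldr_branch (volume_avoiding hℓ hw) hl)] with x hx _ _ using hx
      · exact Eventually.of_forall fun x _ h => absurd h hl
    · exact Eventually.of_forall fun x h => absurd h hw
  filter_upwards [key] with x h hx hi w hw ω n hav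
  obtain ⟨l, -, hl, hlx⟩ := exists_foldr_branch_iterate_L_eq hz hz2 hx hi (p := fun _ => True) ω
    (fun _ => trivial) n
  exact h w l hw (fun t ht => (hl t ht).1) ⟨_, hav, hlx⟩

lemma ae_not_countable_universal_expansions (hℓ : 3 ≤ ℓ) :
    ∀ᵐ x : ℝ, x ∈ Icc (z ℓ) 1 →
      ¬ {a ∈ expansions (z ℓ) x | (∀ n, (a n).2 ≤ ℓ) ∧ IsUniversal (z ℓ) a}.Countable := by
  have hz : 0 < z ℓ := z_pos (by omega)
  have hz3 : z ℓ ≤ 1 / 3 := one_div_le_one_div_of_le three_pos (by exact_mod_cast hℓ)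
  have hz2 : z ℓ ≤ 1 / 2 := by linarith
  have hirr : ∀ᵐ x : ℝ, Irrational x :=
    measure_eq_zero_iff_ae_notMem.1 ((countable_range ((↑) : ℚ → ℝ)).measure_zero volume)
  filter_upwards [hirr, ae_forall_iterate_notMem_avoiding hℓ] with x hi hav hx
  refine not_countable_of_forall_signDigitSeq_mem hz (by linarith) hx hi
    (ι := {w : List (Fin 2 × ℕ) // ∀ t ∈ w, 2 ≤ t.2 ∧ t.2 ≤ ℓ})
    (U := fun w => {ω | ∃ k, ∀ (i : ℕ) (h : i < w.1.length),
      signDigitSeq (z ℓ) ω x (k + i) = w.1[i]}) ?_ ?_ ?_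
  · rintro ⟨w, hw⟩
    simp only [ofPred_exists, Nat.forall_lt_iff_fin]
    refine isOpen_iUnion fun k => ?_
    rw [ofPred_forall]
    refine isOpen_iInter_of_finite fun i => ?_
    exact (isOpen_discrete {w[i]}).preimage
      ((continuous_apply (k + i)).comp (continuous_signDigitSeq (z ℓ) x))
  · rintro ⟨w, hw⟩
    refine dense_of_forall_exists_prefix fun ω₀ n => ?_
    -- The point reached by the prefix does not avoid `w`, so some tail `ω'` produces `w` and is
    -- spliced on.
    have hnot := hav hx hi w hw ω₀ n
    obtain ⟨hy, hyi⟩ := iterate_L_mem hz hz2 hx hi ω₀ n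
    simp only [avoiding, mem_ofPred_eq, hy, hyi, true_and] at hnot
    push Not at hnot
    obtain ⟨ω', k, h⟩ := hnot
    obtain ⟨ω, hω, hL⟩ := exists_iterate_L_eq (z ℓ) x ω₀ ω' n
    refine ⟨ω, ⟨n + k, fun i hi => ?_⟩, hω⟩
    rw [add_assoc, signDigitSeq_add hL]
    exact h i hi
  · intro ω hω
    refine ⟨signDigitSeq_mem_expansions hz hz2 hx hi ω, signDigitSeq_snd_le hℓ hx hi ω, ?_⟩
    intro j w hw
    have hceil : ⌈1 / z ℓ⌉₊ = ℓ := by simp [z]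
    have hw' : ∀ t ∈ List.ofFn w, 2 ≤ t.2 ∧ t.2 ≤ ℓ := by
      intro t ht
      obtain ⟨i, rfl⟩ := (List.mem_ofFn' _ _).1 ht
      have := hw i
      rwa [alphabet, hceil] at this
    obtain ⟨k, hk⟩ := hω ⟨List.ofFn w, hw'⟩
    refine ⟨k, fun i => ?_⟩
    rw [hk i (by simp)]
    simp

end Luroth

theorem theoremC :
    (∀ c : ℝ, 0 < c → c ≤ 2 / 5 → ∀ x ∈ Set.Icc c 1, Irrational x →
      ¬ (Luroth.expansions c x).Countable) ∧
    (∀ ℓ : ℕ, 3 ≤ ℓ → ∀ᵐ x ∂(MeasureTheory.volume : MeasureTheory.Measure ℝ),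
      x ∈ Set.Icc (1 / (ℓ : ℝ)) 1 →
        ¬ {a ∈ Luroth.expansions (1 / (ℓ : ℝ)) x |
            (∀ n, (a n).2 ≤ ℓ) ∧ Luroth.IsUniversal (1 / (ℓ : ℝ)) a}.Countable) := by
  refine ⟨fun c hc0 hc x hx hi => ?_, fun ℓ hℓ => Luroth.ae_not_countable_universal_expansions hℓ⟩
  -- No open dense conditions beyond those of the Baire argument itself are imposed.
  exact Luroth.not_countable_of_forall_signDigitSeq_mem hc0 hc hx hi (ι := Empty)
    (U := fun i => i.elim) (fun i => i.elim) (fun i => i.elim)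
    fun ω _ => Luroth.signDigitSeq_mem_expansions hc0 (by linarith) hx hi ω
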